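/- Let $n$ be a natural number, let $\Delta\subset\mathbb{R}^n$ be the subspace spanned by $(1,\dots,1)$, and let $V=\mathbb{R}^n/\Delta$. Let $R\subset V$ be the set of roots of $\mathrm{SL}(n,\mathbb{C})$, i.e. the classes of the vectors $e_i-e_j$ with $1\le i,j\le n$, $i\ne j$, and let $Q(R)\subset V$ be the root lattice, i.e. the subgroup generated by $R$. For $S\subset V$ write $\overline{S}$ for the convex hull of $S$ in $V$. A finite subset $A$ of $Q(R)$ is called root-saturated if (i) every edge (one-dimensional face) of the polytope $\overline{A}$ is parallel to some root in $R$, and (ii) $A=\overline{A}\cap Q(R)$. If $A$ and $B$ are root-saturated, then so is their Minkowski sum $A+B=\{a+b : a\in A,\ b\in B\}$. -/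

import Mathlib

open scoped Pointwise

noncomputable section

namespace TypeA

/-- The line `Δ` of constant vectors in `ℝⁿ`. -/
abbrev diagonal (n : ℕ) : Submodule ℝ (Fin n → ℝ) :=
  Submodule.span ℝ {fun _ => (1 : ℝ)}

/-- The real vector space `ℝⁿ / Δ` spanned by the weights of `SL(n, ℂ)`, with the quotient
topology. -/
abbrev WeightSpace (n : ℕ) : Type := (Fin n → ℝ) ⧸ diagonal n

/-- The roots of `SL(n, ℂ)`: the classes of `e_i - e_j`, for `i ≠ j`. -/
def roots (n : ℕ) : Set (WeightSpace n) :=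
  {γ | ∃ i j : Fin n, i ≠ j ∧ γ = (diagonal n).mkQ (Pi.single i 1 - Pi.single j 1)}

/-- The root lattice `Q(R)`: the subgroup generated by the roots. -/
def rootLattice (n : ℕ) : AddSubgroup (WeightSpace n) :=
  AddSubgroup.closure (roots n)

/-- `F` is an edge of the polytope `P`: a face (the set of maximizers over `P` of some linear
functional) of dimension one. -/
def IsEdge {n : ℕ} (P F : Set (WeightSpace n)) : Prop :=
  IsExposed ℝ P F ∧ Module.finrank ℝ (vectorSpan ℝ F) = 1

/-- A finite subset `A` of the root lattice is root-saturated if every edge of its convex hull is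
parallel to a root and `A` contains every root lattice point of its convex hull. -/
structure RootSaturated {n : ℕ} (A : Set (WeightSpace n)) : Prop where
  finite : A.Finite
  subset_rootLattice : A ⊆ rootLattice n
  edge_parallel : ∀ F, IsEdge (convexHull ℝ A) F →
    ∃ γ ∈ roots n, vectorSpan ℝ F = Submodule.span ℝ {γ}
  eq_convexHull_inter : A = convexHull ℝ A ∩ rootLattice n

end TypeA

end

/-! A face of a Minkowski sum is the sum of the corresponding faces, so the edges of A + B stay
parallel to roots. For saturation, let x be a lattice point of the hull of A + B and take an extreme
point v of the polytope of all a in the hull of A with x - a in the hull of B. Then v and x - v are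
relatively interior to faces with independent directions. Each direction is spanned by roots
(`EdgesParallelTo.vectorSpan_le`), and sets of roots are unimodular
(`TypeA.mem_closure_of_mem_span`), so x, up to vertices, splits integrally along the two directions.
By independence this splitting is the one given by v, so v is a lattice point. -/

/-- The points of `S` at which the linear functional `g` attains its maximum over `S`. -/
def argmaxOn {E : Type*} [AddCommGroup E] [Module ℝ E] (g : E →ₗ[ℝ] ℝ) (S : Set E) : Set E :=
  {x ∈ S | ∀ y ∈ S, g y ≤ g x}

/-- Every one-dimensional set of maximizers over `S` of a linear functional is parallel to an
element of `Φ`. -/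
def EdgesParallelTo {E : Type*} [AddCommGroup E] [Module ℝ E] (Φ S : Set E) : Prop :=
  ∀ g : E →ₗ[ℝ] ℝ, Module.finrank ℝ (vectorSpan ℝ (argmaxOn g S)) = 1 →
    ∃ γ ∈ Φ, vectorSpan ℝ (argmaxOn g S) = Submodule.span ℝ {γ}

/-! ### Faces and edges of finite sets, hulls and sums -/

section Algebraic

variable {E : Type*} [AddCommGroup E] [Module ℝ E]

theorem argmaxOn_subset (g : E →ₗ[ℝ] ℝ) (S : Set E) : argmaxOn g S ⊆ S := fun _ h => h.1

theorem argmaxOn_nonempty (g : E →ₗ[ℝ] ℝ) {S : Set E} (hS : S.Finite) (hne : S.Nonempty) :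
    (argmaxOn g S).Nonempty := by
  obtain ⟨x, hx, h⟩ := hS.exists_maximalFor g S hne
  refine ⟨x, hx, fun y hy => ?_⟩
  by_contra! hlt
  exact absurd (h hy hlt.le) (not_le.2 hlt)

/-- A face of a face of a finite set is a face. -/
theorem exists_argmaxOn_argmaxOn (h g : E →ₗ[ℝ] ℝ) {S : Set E} (hS : S.Finite) :
    ∃ k : E →ₗ[ℝ] ℝ, argmaxOn k S = argmaxOn g (argmaxOn h S) := by
  -- Lexicographic maximization: on a finite set, N • h + g with N large compares h first and g
  -- second.
  have key : ∀ᶠ N : ℝ in Filter.atTop, ∀ a ∈ S, ∀ b ∈ S, h a < h b →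
      N * h a + g a < N * h b + g b := by
    rw [Filter.eventually_all_finite hS]
    intro a _
    rw [Filter.eventually_all_finite hS]
    intro b _
    by_cases hab : h a < h b
    · filter_upwards [Filter.eventually_gt_atTop ((g a - g b) / (h b - h a))] with N hN _
      rw [div_lt_iff₀ (sub_pos.2 hab)] at hN
      linarith
    · exact Filter.Eventually.of_forall fun _ h' => absurd h' hab
  obtain ⟨N, hN⟩ := key.exists
  refine ⟨N • h + g, ?_⟩
  ext x
  simp only [argmaxOn, Set.mem_ofPred_eq, LinearMap.add_apply, LinearMap.smul_apply, smul_eq_mul]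
  constructor
  · rintro ⟨hx, H⟩
    have hmax : ∀ y ∈ S, h y ≤ h x := by
      intro y hy
      by_contra! hlt
      exact absurd (H y hy) (not_le.2 (hN x hx y hy hlt))
    refine ⟨⟨hx, hmax⟩, fun y hy => ?_⟩
    have h1 := H y hy.1
    rw [le_antisymm (hmax y hy.1) (hy.2 x hx)] at h1
    linarith
  · rintro ⟨⟨hx, hmax⟩, H⟩
    refine ⟨hx, fun y hy => ?_⟩
    rcases (hmax y hy).lt_or_eq with hlt | heq
    · exact (hN y hy x hx hlt).le
    · have := H y ⟨hy, fun z hz => heq ▸ hmax z hz⟩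
      rw [heq]
      linarith

theorem EdgesParallelTo.face {Φ S : Set E} (hS : S.Finite) (H : EdgesParallelTo Φ S)
    (h : E →ₗ[ℝ] ℝ) : EdgesParallelTo Φ (argmaxOn h S) := by
  intro g
  obtain ⟨k, hk⟩ := exists_argmaxOn_argmaxOn h g hS
  rw [← hk]
  exact H k

/-- A finite set on which `l` is not constant has an edge along which `l` is not constant. -/
theorem exists_edge_of_ne {S : Set E} (hS : S.Finite) (l : E →ₗ[ℝ] ℝ) {a b : E}
    (ha : a ∈ S) (hb : b ∈ S) (hab : l a ≠ l b) :
    ∃ g : E →ₗ[ℝ] ℝ, Module.finrank ℝ (vectorSpan ℝ (argmaxOn g S)) = 1 ∧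
      ∃ p ∈ argmaxOn g S, ∃ q ∈ argmaxOn g S, l (q - p) ≠ 0 := by
  -- The values of `w` lie in the kernel of `l`. A functional `m` nonzero on all nonzero values is
  -- generic enough that an edge of the planar shadow under (l, m) comes from an edge of the
  -- polytope.
  let w : E × E × E → E := fun x =>
    l (x.2.2 - x.1) • (x.2.1 - x.1) - l (x.2.1 - x.1) • (x.2.2 - x.1)
  let W : Set E := w '' (S ×ˢ S ×ˢ S) \ {0}
  have hW : W.Finite := ((hS.prod (hS.prod hS)).image w).sdiff
  have : Finite W := hW
  obtain ⟨m, hm⟩ := Module.exists_dual_forall_apply_ne_zero (K := ℝ) (fun v : W => (v : E))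
    (fun v => v.2.2)
  obtain ⟨p, hp, hpm⟩ := argmaxOn_nonempty m (hS.subset (argmaxOn_subset l S))
    (argmaxOn_nonempty l hS ⟨a, ha⟩)
  have hlow : {q ∈ S | l q < l p}.Nonempty := by
    rcases hab.lt_or_gt with h | h
    · exact ⟨a, ha, h.trans_le (hp.2 b hb)⟩
    · exact ⟨b, hb, h.trans_le (hp.2 a ha)⟩
  obtain ⟨q, ⟨hqS, hqp⟩, hq⟩ := (hS.subset (Set.sep_subset S fun q => l q < l p)).exists_maximalFor
    (fun q => (m q - m p) / (l p - l q)) _ hlow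
  -- The top point `p` stays maximal while `m` is tilted by `l`; `t` is the critical tilt at which a
  -- lower point `q` first ties with it.
  set t : ℝ := (m q - m p) / (l p - l q) with ht
  have hmq : m q + t * l q = m p + t * l p := by
    rw [ht]; field_simp [(sub_pos.2 hqp).ne']; ring
  have hpmax : ∀ y ∈ S, m y + t * l y ≤ m p + t * l p := by
    intro y hy
    rcases (hp.2 y hy).lt_or_eq with hlt | heq
    · have h1 : (m y - m p) / (l p - l y) ≤ t := by
        by_contra! h2
        exact absurd (hq ⟨hy, hlt⟩ h2.le) (not_le.2 h2)
      rw [div_le_iff₀ (sub_pos.2 hlt)] at h1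
      linarith
    · have := hpm y ⟨hy, fun z hz => heq ▸ hp.2 z hz⟩
      rw [heq]; linarith
  have hlqp : l (q - p) ≠ 0 := by rw [map_sub]; exact (sub_neg.2 hqp).ne
  have hpA : p ∈ argmaxOn (m + t • l) S := ⟨hp.1, fun y hy => by simpa using hpmax y hy⟩
  have hqA : q ∈ argmaxOn (m + t • l) S :=
    ⟨hqS, fun y hy => by simpa [hmq] using hpmax y hy⟩
  refine ⟨m + t • l, ?_, p, hpA, q, hqA, hlqp⟩
  have hline : vectorSpan ℝ (argmaxOn (m + t • l) S) = Submodule.span ℝ {q - p} := by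
    rw [vectorSpan_eq_span_vsub_set_right ℝ hpA]
    apply le_antisymm
    · rw [Submodule.span_le]
      rintro _ ⟨r, hr, rfl⟩
      have hrp : m r + t * l r = m p + t * l p :=
        le_antisymm (hpmax r hr.1) (by simpa using hr.2 p hp.1)
      have hw0 : w (p, q, r) = 0 := by
        by_contra hne
        refine hm ⟨w (p, q, r), ⟨(p, q, r), ⟨hp.1, hqS, hr.1⟩, rfl⟩, hne⟩ ?_
        have e1 : m r - m p = -t * (l r - l p) := by linarith
        have e2 : m q - m p = -t * (l q - l p) := by linarith
        simp only [w, map_sub, map_smul, smul_eq_mul, e1, e2]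
        ring
      refine Submodule.mem_span_singleton.2 ⟨(l (q - p))⁻¹ * l (r - p), ?_⟩
      rw [mul_smul, inv_smul_eq_iff₀ hlqp]
      exact sub_eq_zero.1 hw0
    · rw [Submodule.span_singleton_le_iff_mem]
      exact Submodule.subset_span ⟨q, hqA, rfl⟩
  rw [hline]
  exact finrank_span_singleton fun h0 => hlqp (by rw [h0, map_zero])

/-- The direction space of a polytope all of whose edges are parallel to elements of `Φ` is spanned
by elements of `Φ`. -/
theorem EdgesParallelTo.vectorSpan_le {Φ S : Set E} (hS : S.Finite) (H : EdgesParallelTo Φ S) :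
    vectorSpan ℝ S ≤ Submodule.span ℝ (Φ ∩ vectorSpan ℝ S) := by
  intro u hu
  by_contra hnot
  obtain ⟨l, hlu, hl⟩ := Submodule.exists_le_ker_of_notMem hnot
  have hne : ∃ a ∈ S, ∃ b ∈ S, l a ≠ l b := by
    by_contra! hconst
    apply hlu
    have : vectorSpan ℝ S ≤ LinearMap.ker l := by
      rw [vectorSpan_def, Submodule.span_le]
      rintro _ ⟨a, ha, b, hb, rfl⟩
      simp [hconst a ha b hb]
    exact this hu
  obtain ⟨a, ha, b, hb, hab⟩ := hne
  obtain ⟨g, hg, p, hp, q, hq, hpq⟩ := exists_edge_of_ne hS l ha hb hab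
  obtain ⟨γ, hγ, hspan⟩ := H g hg
  have hγS : γ ∈ vectorSpan ℝ S := by
    apply vectorSpan_mono ℝ (argmaxOn_subset g S)
    rw [hspan]
    exact Submodule.mem_span_singleton_self γ
  have hlγ : l γ = 0 := hl (Submodule.subset_span ⟨hγ, hγS⟩)
  have hmem : q - p ∈ Submodule.span ℝ {γ} := hspan ▸ vsub_mem_vectorSpan ℝ hq hp
  obtain ⟨c, hc⟩ := Submodule.mem_span_singleton.1 hmem
  exact hpq (by rw [← hc, map_smul, hlγ, smul_zero])

/-- If `g` attains its maximum over `S` at a point of the convex hull, then this point lies in the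
convex hull of the points of `S` with the same value. -/
theorem mem_convexHull_level {S : Set E} {g : E →ₗ[ℝ] ℝ} {x : E} (hx : x ∈ convexHull ℝ S)
    (h : ∀ s ∈ S, g s ≤ g x) : x ∈ convexHull ℝ {s ∈ S | g s = g x} := by
  have hSplit : S = {s ∈ S | g s = g x} ∪ {s ∈ S | g s < g x} := by
    ext s
    have := h s
    simp only [Set.mem_union, Set.mem_ofPred_eq, ← and_or_left]
    exact ⟨fun hs => ⟨hs, (h s hs).eq_or_lt⟩, fun hs => hs.1⟩
  have hlt : ∀ y ∈ convexHull ℝ {s ∈ S | g s < g x}, g y < g x := fun y hy =>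
    convexHull_min (fun s hs => hs.2) (convex_halfSpace_lt g.isLinear (g x)) hy
  have heq : ∀ y ∈ convexHull ℝ {s ∈ S | g s = g x}, g y = g x := fun y hy =>
    convexHull_min (fun s hs => hs.2) (convex_hyperplane g.isLinear (g x)) hy
  rcases Set.eq_empty_or_nonempty {s ∈ S | g s < g x} with he | hne
  · rw [he, Set.union_empty] at hSplit
    rwa [← hSplit]
  rcases Set.eq_empty_or_nonempty {s ∈ S | g s = g x} with he' | hne'
  · rw [he', Set.empty_union] at hSplit
    rw [hSplit] at hx
    exact absurd (hlt x hx) (lt_irrefl _)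
  · have hx' := hx
    rw [hSplit, convexHull_union hne' hne, mem_convexJoin] at hx'
    obtain ⟨y, hy, z, hz, α, β, hα, hβ, hαβ, hxyz⟩ := hx'
    have h1 : α * g y + β * g z = g x := by rw [← hxyz]; simp
    rw [heq y hy] at h1
    have h2 := hlt z hz
    have hβ0 : β = 0 := by
      by_contra hb
      have : 0 < β := lt_of_le_of_ne hβ (Ne.symm hb)
      have : α = 1 - β := by linarith
      subst this
      nlinarith
    rw [hβ0, add_zero] at hαβ
    have hxy : x = y := by rw [← hxyz, hβ0, hαβ, one_smul, zero_smul, add_zero]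
    exact hxy ▸ heq y hy ▸ hy

theorem le_of_mem_convexHull {S : Set E} {g : E →ₗ[ℝ] ℝ} {c : ℝ} (h : ∀ s ∈ S, g s ≤ c) {y : E}
    (hy : y ∈ convexHull ℝ S) : g y ≤ c :=
  convexHull_min (fun s hs => h s hs) (convex_halfSpace_le g.isLinear c) hy

/-- The face of the convex hull of `S` maximizing `g` is the convex hull of the maximizers in
`S`. -/
theorem argmaxOn_convexHull (g : E →ₗ[ℝ] ℝ) (S : Set E) :
    argmaxOn g (convexHull ℝ S) = convexHull ℝ (argmaxOn g S) := by
  apply Set.Subset.antisymm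
  · rintro x ⟨hx, h⟩
    refine convexHull_mono ?_
      (mem_convexHull_level hx fun s hs => h s (subset_convexHull ℝ S hs))
    exact fun s hs => ⟨hs.1, fun y hy => hs.2 ▸ h y (subset_convexHull ℝ S hy)⟩
  · intro x hx
    refine ⟨convexHull_mono (argmaxOn_subset g S) hx, fun y hy => ?_⟩
    refine le_of_mem_convexHull (fun s hs => ?_) hy
    have h1 : argmaxOn g S ⊆ {z | g s ≤ g z} := fun z hz => hz.2 s hs
    exact convexHull_min h1 (convex_halfSpace_ge g.isLinear (g s)) hx

theorem vectorSpan_convexHull (S : Set E) : vectorSpan ℝ (convexHull ℝ S) = vectorSpan ℝ S := by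
  rw [← direction_affineSpan, affineSpan_convexHull, direction_affineSpan]

theorem argmaxOn_add (g : E →ₗ[ℝ] ℝ) (S T : Set E) :
    argmaxOn g (S + T) = argmaxOn g S + argmaxOn g T := by
  ext x
  constructor
  · rintro ⟨⟨s, hs, t, ht, rfl⟩, h⟩
    refine ⟨s, ⟨hs, fun y hy => ?_⟩, t, ⟨ht, fun y hy => ?_⟩, rfl⟩
    · simpa using h _ (Set.add_mem_add hy ht)
    · simpa using h _ (Set.add_mem_add hs hy)
  · rintro ⟨s, hs, t, ht, rfl⟩
    refine ⟨Set.add_mem_add hs.1 ht.1, ?_⟩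
    rintro _ ⟨y, hy, z, hz, rfl⟩
    simpa using add_le_add (hs.2 y hy) (ht.2 z hz)

theorem vectorSpan_add {S T : Set E} (hS : S.Nonempty) (hT : T.Nonempty) :
    vectorSpan ℝ (S + T) = vectorSpan ℝ S ⊔ vectorSpan ℝ T := by
  apply le_antisymm
  · rw [vectorSpan_def, Submodule.span_le]
    rintro _ ⟨_, ⟨s, hs, t, ht, rfl⟩, _, ⟨s', hs', t', ht', rfl⟩, rfl⟩
    have : s + t -ᵥ (s' + t') = (s -ᵥ s') + (t -ᵥ t') := by simp only [vsub_eq_sub]; abel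
    simp only [this]
    exact Submodule.add_mem_sup (vsub_mem_vectorSpan ℝ hs hs') (vsub_mem_vectorSpan ℝ ht ht')
  · obtain ⟨s₀, hs₀⟩ := hS
    obtain ⟨t₀, ht₀⟩ := hT
    apply sup_le
    · rw [vectorSpan_def, Submodule.span_le]
      rintro _ ⟨s, hs, s', hs', rfl⟩
      simpa using vsub_mem_vectorSpan ℝ (Set.add_mem_add hs ht₀) (Set.add_mem_add hs' ht₀)
    · rw [vectorSpan_def, Submodule.span_le]
      rintro _ ⟨s, hs, s', hs', rfl⟩
      simpa using vsub_mem_vectorSpan ℝ (Set.add_mem_add hs₀ hs) (Set.add_mem_add hs₀ hs')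

/-- The direction of a face of the sum is the sum of the directions of its two summand faces. If
that is a line, each summand contributes zero or the whole line. -/
theorem EdgesParallelTo.add {Φ S T : Set E} (hS : EdgesParallelTo Φ S) (hT : EdgesParallelTo Φ T)
    [FiniteDimensional ℝ E] : EdgesParallelTo Φ (S + T) := by
  intro g hg
  rw [argmaxOn_add] at hg ⊢
  rcases Set.eq_empty_or_nonempty (argmaxOn g S + argmaxOn g T) with he | hne
  · have h : (1 : ℕ) = 0 := by
      rw [← hg, he, vectorSpan_empty, finrank_bot]
    exact absurd h one_ne_zero
  rw [vectorSpan_add hne.of_add_left hne.of_add_right] at hg ⊢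
  by_cases h0 : vectorSpan ℝ (argmaxOn g S) = ⊥
  · rw [h0, bot_sup_eq] at hg ⊢
    exact hT g hg
  · have h1 : Module.finrank ℝ (vectorSpan ℝ (argmaxOn g S)) = 1 := by
      apply le_antisymm
      · rw [← hg]; exact Submodule.finrank_mono le_sup_left
      · exact Submodule.one_le_finrank_iff.2 h0
    rw [← Submodule.eq_of_le_of_finrank_eq (le_sup_left (a := vectorSpan ℝ (argmaxOn g S))
      (b := vectorSpan ℝ (argmaxOn g T))) (h1.trans hg.symm)]
    exact hS g h1

end Algebraic

/-! ### Relative interiors and integer decomposition -/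

section Normed

variable {E : Type*} [NormedAddCommGroup E] [NormedSpace ℝ E] [FiniteDimensional ℝ E]

/-- A point of the convex hull of `S` is either in its relative interior or on a proper face. -/
theorem eventually_mem_convexHull_or_exists_lt {S : Set E} {v : E} (hv : v ∈ convexHull ℝ S) :
    (∀ u ∈ vectorSpan ℝ S, ∀ᶠ t : ℝ in nhds 0, v + t • u ∈ convexHull ℝ S) ∨
      ∃ h : E →ₗ[ℝ] ℝ, (∀ s ∈ S, h s ≤ h v) ∧ ∃ s ∈ S, h s < h v := by
  have hvD : ∀ s ∈ S, s - v ∈ vectorSpan ℝ S := fun s hs => by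
    rw [← vectorSpan_convexHull]
    exact vsub_mem_vectorSpan ℝ (subset_convexHull ℝ S hs) hv
  -- The hull, recentred at `v` inside its own direction space, where it has nonempty interior.
  let C : Set (vectorSpan ℝ S) := {d | v + (d : E) ∈ convexHull ℝ S}
  have hC : Convex ℝ C :=
    ((convex_convexHull ℝ S).translate_preimage_right v).linear_preimage (vectorSpan ℝ S).subtype
  have h0 : (0 : vectorSpan ℝ S) ∈ C := by simpa [C] using hv
  have hsC : ∀ s (hs : s ∈ S), (⟨s - v, hvD s hs⟩ : vectorSpan ℝ S) ∈ C := fun s hs => by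
    simpa [C] using subset_convexHull ℝ S hs
  have hspan : Submodule.span ℝ C = ⊤ := by
    apply Submodule.map_injective_of_injective (vectorSpan ℝ S).injective_subtype
    rw [Submodule.map_top, Submodule.range_subtype]
    apply le_antisymm (Submodule.map_subtype_le _ _)
    conv_lhs => rw [vectorSpan_def]
    rw [Submodule.span_le]
    rintro _ ⟨s, hs, s', hs', rfl⟩
    refine ⟨⟨s - v, hvD s hs⟩ - ⟨s' - v, hvD s' hs'⟩, Submodule.sub_mem _
      (Submodule.subset_span (hsC s hs)) (Submodule.subset_span (hsC s' hs')), by simp⟩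
  have hint : (interior C).Nonempty := by
    rw [hC.interior_nonempty_iff_affineSpan_eq_top,
      AffineSubspace.affineSpan_eq_top_iff_vectorSpan_eq_top_of_nonempty ℝ _ _ ⟨0, h0⟩,
      vectorSpan_eq_span_vsub_set_right ℝ h0]
    simpa using hspan
  by_cases hmem : (0 : vectorSpan ℝ S) ∈ interior C
  · left
    intro u hu
    have hcont : Filter.Tendsto (fun t : ℝ => t • (⟨u, hu⟩ : vectorSpan ℝ S)) (nhds 0)
        (nhds 0) := by
      have : Continuous fun t : ℝ => t • (⟨u, hu⟩ : vectorSpan ℝ S) := by fun_prop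
      simpa using this.tendsto 0
    filter_upwards [hcont (mem_interior_iff_mem_nhds.1 hmem)] with t ht using ht
  · right
    obtain ⟨f, hf⟩ := geometric_hahn_banach_open_point hC.interior isOpen_interior hmem
    rw [map_zero] at hf
    obtain ⟨h, hh⟩ := LinearMap.exists_extend f.toLinearMap
    have hhf : ∀ d : vectorSpan ℝ S, h d = f d := fun d => LinearMap.congr_fun hh d
    have hle : ∀ d ∈ C, f d ≤ 0 := by
      intro d hd
      have h1 : d ∈ closure (interior C) := by
        rw [hC.closure_interior_eq_closure_of_nonempty_interior hint]
        exact subset_closure hd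
      exact closure_minimal (fun a ha => (hf a ha).le)
        (isClosed_le f.continuous continuous_const) h1
    have hsv : ∀ s (hs : s ∈ S), h s - h v = f ⟨s - v, hvD s hs⟩ := fun s hs => by
      rw [← hhf, ← map_sub]
    refine ⟨h, fun s hs => ?_, ?_⟩
    · have := hle _ (hsC s hs)
      rw [← hsv s hs] at this
      linarith
    -- If `h` were constant on `S`, it would vanish on the direction space, yet it is negative on
    -- the interior of `C`.
    · by_contra! hge
      have heq : ∀ s ∈ S, h s = h v := fun s hs => by
        have := hle _ (hsC s hs)
        rw [← hsv s hs] at this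
        linarith [hge s hs]
      have hker : vectorSpan ℝ S ≤ LinearMap.ker h := by
        rw [vectorSpan_def, Submodule.span_le]
        rintro _ ⟨s, hs, s', hs', rfl⟩
        simp [heq s hs, heq s' hs']
      obtain ⟨a, ha⟩ := hint
      have := hf a ha
      rw [← hhf a, LinearMap.mem_ker.1 (hker a.2)] at this
      exact lt_irrefl _ this

/-- Every point of a polytope lies in the relative interior of a face. -/
theorem EdgesParallelTo.exists_face {Φ A : Set E} (hA : A.Finite) (H : EdgesParallelTo Φ A)
    {v : E} (hv : v ∈ convexHull ℝ A) :
    ∃ S ⊆ A, EdgesParallelTo Φ S ∧ v ∈ convexHull ℝ S ∧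
      ∀ u ∈ vectorSpan ℝ S, ∀ᶠ t : ℝ in nhds 0, v + t • u ∈ convexHull ℝ S := by
  have hfin : {S | S ⊆ A ∧ EdgesParallelTo Φ S ∧ v ∈ convexHull ℝ S}.Finite :=
    hA.finite_subsets.subset fun S hS => hS.1
  obtain ⟨S, ⟨hSA, hES, hvS⟩, hmin⟩ := hfin.exists_minimal ⟨A, subset_rfl, H, hv⟩
  refine ⟨S, hSA, hES, hvS, ?_⟩
  rcases eventually_mem_convexHull_or_exists_lt hvS with h | ⟨h, hle, s, hs, hlt⟩
  · exact h
  exfalso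
  have hv' : v ∈ convexHull ℝ (argmaxOn h S) := by
    rw [← argmaxOn_convexHull]
    exact ⟨hvS, fun y hy => le_of_mem_convexHull hle hy⟩
  have hsub := argmaxOn_subset h S
  have hs' := hmin ⟨hsub.trans hSA, hES.face (hA.subset hSA) h, hv'⟩ hsub hs
  have : h v ≤ h s := le_of_mem_convexHull hs'.2 hvS
  exact absurd this (not_le.2 hlt)

/-- Integer decomposition for polytopes with edges in a unimodular set of directions: a lattice
point of the Minkowski sum of two lattice polytopes is a sum of lattice points. -/
theorem exists_add_eq_of_mem_convexHull_add {Φ : Set E}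
    (hΦ : ∀ T ⊆ Φ, ∀ u ∈ Submodule.span ℝ T, u ∈ AddSubgroup.closure Φ →
      u ∈ AddSubgroup.closure T)
    {A B : Set E} (hA : A.Finite) (hB : B.Finite)
    (hAΦ : A ⊆ AddSubgroup.closure Φ) (hBΦ : B ⊆ AddSubgroup.closure Φ)
    (HA : EdgesParallelTo Φ A) (HB : EdgesParallelTo Φ B) {x : E}
    (hx : x ∈ convexHull ℝ (A + B)) (hxΦ : x ∈ AddSubgroup.closure Φ) :
    ∃ a ∈ convexHull ℝ A ∩ AddSubgroup.closure Φ, ∃ b ∈ convexHull ℝ B ∩ AddSubgroup.closure Φ,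
      a + b = x := by
  let K : Set E := convexHull ℝ A ∩ (fun y => x - y) ⁻¹' convexHull ℝ B
  have hKne : K.Nonempty := by
    rw [convexHull_add] at hx
    obtain ⟨a, ha, b, hb, rfl⟩ := hx
    exact ⟨a, ha, by simpa using hb⟩
  have hK : IsCompact K := (hA.isCompact_convexHull ℝ).inter_right
    ((hB.isCompact_convexHull ℝ).isClosed.preimage (by fun_prop))
  obtain ⟨v, ⟨hvA, hvB⟩, hext⟩ := hK.extremePoints_nonempty hKne
  obtain ⟨S, hSA, hES, hvS, hS⟩ := HA.exists_face hA hvA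
  obtain ⟨T, hTB, hET, hvT, hT⟩ := HB.exists_face hB hvB
  -- A common direction u would make v the midpoint of v + t • u and v - t • u, both in `K` for
  -- small t > 0.
  have hdisj : ∀ u ∈ vectorSpan ℝ S, u ∈ vectorSpan ℝ T → u = 0 := by
    intro u huS huT
    have hneg : Filter.Tendsto (fun t : ℝ => -t) (nhds 0) (nhds 0) := by
      simpa using (continuous_neg (G := ℝ)).tendsto 0
    have hev : ∀ᶠ t : ℝ in nhds 0, v + t • u ∈ K := by
      filter_upwards [hS u huS, hneg.eventually (hT u huT)] with t h1 h2
      refine ⟨convexHull_mono hSA h1, convexHull_mono hTB ?_⟩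
      have : x - (v + t • u) = x - v + (-t) • u := by rw [neg_smul]; abel
      simpa only [Set.mem_preimage, this] using h2
    have hev' := (hev.and (hneg.eventually hev)).filter_mono
      (nhdsWithin_le_nhds (s := Set.Ioi 0))
    obtain ⟨t, ⟨h1, h2⟩, ht⟩ := (hev'.and self_mem_nhdsWithin).exists
    have hopen : v ∈ openSegment ℝ (v + t • u) (v + (-t) • u) :=
      ⟨1 / 2, 1 / 2, by norm_num, by norm_num, by norm_num, by module⟩
    have h3 := hext h1 h2 hopen
    have h4 : t • u = 0 := by simpa using h3
    exact (smul_eq_zero.1 h4).resolve_left (ne_of_gt ht)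
  obtain ⟨p, hp⟩ : S.Nonempty := convexHull_nonempty_iff.1 ⟨v, hvS⟩
  obtain ⟨q, hq⟩ : T.Nonempty := convexHull_nonempty_iff.1 ⟨_, hvT⟩
  have hpv : v - p ∈ vectorSpan ℝ S := by
    rw [← vectorSpan_convexHull]
    exact vsub_mem_vectorSpan ℝ hvS (subset_convexHull ℝ S hp)
  have hqv : x - v - q ∈ vectorSpan ℝ T := by
    rw [← vectorSpan_convexHull]
    exact vsub_mem_vectorSpan ℝ hvT (subset_convexHull ℝ T hq)
  have hpΦ := hAΦ (hSA hp)
  have hqΦ := hBΦ (hTB hq)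
  set R₁ := Φ ∩ vectorSpan ℝ S
  set R₂ := Φ ∩ vectorSpan ℝ T
  have hsum : x - p - q ∈ AddSubgroup.closure (R₁ ∪ R₂) := by
    refine hΦ _ (Set.union_subset Set.inter_subset_left Set.inter_subset_left) _ ?_
      (sub_mem (sub_mem hxΦ hpΦ) hqΦ)
    have : x - p - q = (v - p) + (x - v - q) := by abel
    rw [this, Submodule.span_union]
    exact Submodule.add_mem_sup (hES.vectorSpan_le (hA.subset hSA) hpv)
      (hET.vectorSpan_le (hB.subset hTB) hqv)
  rw [AddSubgroup.closure_union, AddSubgroup.mem_sup] at hsum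
  obtain ⟨y, hy, z, hz, hyz⟩ := hsum
  have hyS : y ∈ vectorSpan ℝ S :=
    (AddSubgroup.closure_le (vectorSpan ℝ S).toAddSubgroup).2 Set.inter_subset_right hy
  have hzT : z ∈ vectorSpan ℝ T :=
    (AddSubgroup.closure_le (vectorSpan ℝ T).toAddSubgroup).2 Set.inter_subset_right hz
  have hyv : v - p = y := by
    refine sub_eq_zero.1 (hdisj _ (sub_mem hpv hyS) ?_)
    have : v - p - y = z - (x - v - q) := by
      rw [eq_sub_of_add_eq' hyz]; abel
    rw [this]
    exact sub_mem hzT hqv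
  have hvΦ : v ∈ AddSubgroup.closure Φ := by
    rw [← sub_add_cancel v p, hyv]
    exact add_mem (AddSubgroup.closure_mono Set.inter_subset_left hy) hpΦ
  exact ⟨v, ⟨hvA, hvΦ⟩, x - v, ⟨hvB, sub_mem hxΦ hvΦ⟩, by abel⟩

end Normed

/-! ### Roots of type A: unimodularity and edges -/

namespace TypeA

variable {n : ℕ}

/-- The lift of a weight to the vector of the class whose coordinates sum to zero. -/
noncomputable def sumZeroLift (n : ℕ) : WeightSpace n →ₗ[ℝ] (Fin n → ℝ) :=
  (diagonal n).liftQ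
    (LinearMap.id - (LinearMap.toSpanSingleton ℝ (Fin n → ℝ) fun _ => (n : ℝ)⁻¹) ∘ₗ
      ∑ i, LinearMap.proj i) (by
    rw [Submodule.span_singleton_le_iff_mem, LinearMap.mem_ker]
    ext i
    have hn : (n : ℝ) ≠ 0 := Nat.cast_ne_zero.2 (Fin.pos i).ne'
    simp [hn])

theorem sumZeroLift_mk (x : Fin n → ℝ) (i : Fin n) :
    sumZeroLift n ((diagonal n).mkQ x) i = x i - (∑ j, x j) * (n : ℝ)⁻¹ := by
  simp [sumZeroLift, Finset.sum_mul]

theorem mkQ_sumZeroLift (u : WeightSpace n) : (diagonal n).mkQ (sumZeroLift n u) = u := by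
  obtain ⟨x, rfl⟩ := (diagonal n).mkQ_surjective u
  rw [← sub_eq_zero, ← map_sub, Submodule.mkQ_apply, Submodule.Quotient.mk_eq_zero,
    Submodule.mem_span_singleton]
  refine ⟨-((∑ j, x j) * (n : ℝ)⁻¹), ?_⟩
  ext i
  rw [Pi.sub_apply, sumZeroLift_mk]
  simp

theorem sumZeroLift_root (i j : Fin n) :
    sumZeroLift n ((diagonal n).mkQ (Pi.single i 1 - Pi.single j 1)) =
      Pi.single i 1 - Pi.single j 1 := by
  ext k
  rw [sumZeroLift_mk]
  simp

theorem exists_int_sumZeroLift {u : WeightSpace n} (hu : u ∈ rootLattice n) :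
    ∃ z : Fin n → ℤ, ∀ i, sumZeroLift n u i = z i := by
  induction hu using AddSubgroup.closure_induction with
  | mem x hx =>
    obtain ⟨i, j, -, rfl⟩ := hx
    refine ⟨Pi.single i 1 - Pi.single j 1, fun k => ?_⟩
    rw [sumZeroLift_root]
    simp [Pi.single_apply]
  | zero => exact ⟨0, by simp⟩
  | add x y _ _ hx hy =>
    obtain ⟨z, hz⟩ := hx
    obtain ⟨w, hw⟩ := hy
    exact ⟨z + w, fun i => by simp [hz, hw]⟩
  | neg x _ hx =>
    obtain ⟨z, hz⟩ := hx
    exact ⟨-z, fun i => by simp [hz]⟩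

/-- The set of roots is unimodular: an element of the root lattice in the real span of a set of
roots is an integral combination of these roots. -/
theorem mem_closure_of_mem_span {T : Set (WeightSpace n)} (hT : T ⊆ roots n) {u : WeightSpace n}
    (hu : u ∈ Submodule.span ℝ T) (hQ : u ∈ rootLattice n) : u ∈ AddSubgroup.closure T := by
  classical
  let d : Fin n → Fin n → WeightSpace n := fun i j =>
    (diagonal n).mkQ (Pi.single i 1 - Pi.single j 1)
  have dadd : ∀ i j k, d i j + d j k = d i k := fun i j k => by
    simp only [d, ← map_add, sub_add_sub_cancel]
  -- View `T` as a graph on the indices. Coordinate sums over each class vanish on the span of `T`,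
  -- so moving every coordinate to its class representative cancels, leaving integer multiples of
  -- elements of the closure of `T`.
  let r : Setoid (Fin n) :=
    { r := fun i j => d i j ∈ AddSubgroup.closure T
      iseqv :=
        { refl := fun i => by simp [d]
          symm := fun {i j} h => by
            have : d j i = -d i j := by simp only [d, ← map_neg, neg_sub]
            rw [this]
            exact neg_mem h
          trans := fun {i j k} h h' => dadd i j k ▸ add_mem h h' } }
  let σ : Quotient r → (Fin n → ℝ) →ₗ[ℝ] ℝ := fun c =>
    ∑ i with (⟦i⟧ : Quotient r) = c, LinearMap.proj i
  have hσ : ∀ c x, σ c x = ∑ i with (⟦i⟧ : Quotient r) = c, x i := fun c x => by simp [σ]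
  have hσu : ∀ c, σ c (sumZeroLift n u) = 0 := by
    intro c
    have hle : Submodule.span ℝ T ≤ LinearMap.ker (σ c ∘ₗ sumZeroLift n) := by
      rw [Submodule.span_le]
      intro γ hγ
      obtain ⟨i, j, -, rfl⟩ := hT hγ
      have hij : (⟦i⟧ : Quotient r) = ⟦j⟧ := Quotient.sound (AddSubgroup.subset_closure hγ)
      simp only [SetLike.mem_coe, LinearMap.mem_ker, LinearMap.comp_apply, sumZeroLift_root, hσ]
      simp [Finset.sum_sub_distrib, hij]
    exact hle hu
  obtain ⟨z, hz⟩ := exists_int_sumZeroLift hQ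
  have hx : sumZeroLift n u = ∑ i, sumZeroLift n u i •
      (Pi.single i 1 - Pi.single (⟦i⟧ : Quotient r).out 1 : Fin n → ℝ) := by
    simp only [smul_sub, Finset.sum_sub_distrib]
    have h1 : ∑ i, sumZeroLift n u i • (Pi.single i 1 : Fin n → ℝ) = sumZeroLift n u :=
      (pi_eq_sum_univ' _).symm
    have h2 : ∑ i, sumZeroLift n u i • (Pi.single (⟦i⟧ : Quotient r).out 1 : Fin n → ℝ) = 0 := by
      rw [← Finset.sum_fiberwise Finset.univ (fun i => (⟦i⟧ : Quotient r))]
      refine Finset.sum_eq_zero fun c _ => ?_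
      rw [Finset.sum_congr rfl (g := fun i => sumZeroLift n u i • Pi.single c.out 1)
        fun i hi => by rw [(Finset.mem_filter.1 hi).2], ← Finset.sum_smul, ← hσ, hσu, zero_smul]
    rw [h1, h2, sub_zero]
  rw [← mkQ_sumZeroLift u, hx, map_sum]
  refine sum_mem fun i _ => ?_
  rw [map_smul, hz, Int.cast_smul_eq_zsmul]
  exact zsmul_mem (r.symm (Quotient.mk_out i)) _

theorem continuous_linearMap (g : WeightSpace n →ₗ[ℝ] ℝ) : Continuous g :=
  continuous_coinduced_dom.2 (g ∘ₗ (diagonal n).mkQ).continuous_of_finiteDimensional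

theorem isEdge_argmaxOn {P : Set (WeightSpace n)} (g : WeightSpace n →ₗ[ℝ] ℝ)
    (h : Module.finrank ℝ (vectorSpan ℝ (argmaxOn g P)) = 1) : IsEdge P (argmaxOn g P) :=
  ⟨fun _ => ⟨⟨g, continuous_linearMap g⟩, rfl⟩, h⟩

theorem IsEdge.exists_eq_argmaxOn {P F : Set (WeightSpace n)} (h : IsEdge P F) :
    ∃ g : WeightSpace n →ₗ[ℝ] ℝ, F = argmaxOn g P := by
  have hne : F.Nonempty := by
    by_contra he
    have h0 : (1 : ℕ) = 0 := by
      rw [← h.2, Set.not_nonempty_iff_eq_empty.1 he, vectorSpan_empty, finrank_bot]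
    exact absurd h0 one_ne_zero
  obtain ⟨l, hl⟩ := h.1 hne
  exact ⟨l.toLinearMap, hl⟩

/-- Maximizers on the hull form the hull of the maximizers on `A`, with the same direction, so edges
can be studied on the finite set. -/
theorem edgesParallelTo_roots_iff {A : Set (WeightSpace n)} :
    EdgesParallelTo (roots n) A ↔ ∀ F, IsEdge (convexHull ℝ A) F →
      ∃ γ ∈ roots n, vectorSpan ℝ F = Submodule.span ℝ {γ} := by
  have key : ∀ g : WeightSpace n →ₗ[ℝ] ℝ,
      vectorSpan ℝ (argmaxOn g (convexHull ℝ A)) = vectorSpan ℝ (argmaxOn g A) := fun g => by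
    rw [argmaxOn_convexHull, vectorSpan_convexHull]
  constructor
  · intro H F hF
    obtain ⟨g, rfl⟩ := hF.exists_eq_argmaxOn
    rw [key]
    exact H g (key g ▸ hF.2)
  · intro H g hg
    rw [← key] at hg ⊢
    exact H _ (isEdge_argmaxOn g hg)

end TypeA

theorem theorem4p4 (n : ℕ) (A B : Set (TypeA.WeightSpace n))
    (hA : TypeA.RootSaturated A) (hB : TypeA.RootSaturated B) :
    TypeA.RootSaturated (A + B) := by
  have hEA := TypeA.edgesParallelTo_roots_iff.2 hA.edge_parallel
  have hEB := TypeA.edgesParallelTo_roots_iff.2 hB.edge_parallel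
  have hsub : A + B ⊆ TypeA.rootLattice n := by
    rintro _ ⟨a, ha, b, hb, rfl⟩
    exact add_mem (hA.subset_rootLattice ha) (hB.subset_rootLattice hb)
  -- Closedness of Δ makes the quotient seminorm a norm, as the decomposition theorem requires.
  have : IsClosed (TypeA.diagonal n : Set (Fin n → ℝ)) := Submodule.closed_of_finiteDimensional _
  refine ⟨hA.finite.add hB.finite, hsub, TypeA.edgesParallelTo_roots_iff.1 (hEA.add hEB),
    Set.Subset.antisymm (fun x hx => ⟨subset_convexHull ℝ _ hx, hsub hx⟩) ?_⟩
  rintro x ⟨hx, hxQ⟩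
  obtain ⟨a, ha, b, hb, rfl⟩ := exists_add_eq_of_mem_convexHull_add (Φ := TypeA.roots n)
    (fun T hT u hu hQ => TypeA.mem_closure_of_mem_span hT hu hQ)
    hA.finite hB.finite hA.subset_rootLattice hB.subset_rootLattice hEA hEB hx hxQ
  exact Set.add_mem_add (hA.eq_convexHull_inter.ge ha) (hB.eq_convexHull_inter.ge hb)
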